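/- For a prime $p\equiv 3\pmod 4$ put $q=p^3$ and $\mathbb Z_q=\mathbb Z/q\mathbb Z$. For $v=(v_1,v_2)\in\mathbb Z_q^2$ let $\|v\|=v_1^2+v_2^2\in\mathbb Z_q$; for $x,y\in\mathbb Z_q^2$ let $B(x,y)=\{z\in\mathbb Z_q^2:\|z-x\|=\|z-y\|\}$, and for $P\subseteq\mathbb Z_q^2$ let $B(P)=\{B(x,y): x,y\in P\}$. A reflection is a map $v\mapsto S(v-u)+u$ of $\mathbb Z_q^2$ with $u\in\mathbb Z_q^2$ and $S=\begin{pmatrix}a&b\\ b&-a\end{pmatrix}$, $a^2+b^2=1$. A line $\{z: az_1+bz_2=c\}$ is non-isotropic if $a$, $b$ and $a^2+b^2$ are units of $\mathbb Z_q$, and a reflection is non-isotropic if its set of fixed points is a non-isotropic line. For $x=(x_1,x_2)$ and $y=(y_1,y_2)$ in $\mathbb Z_q^2\times\mathbb Z_q^2$ let $\mathcal N(x,y)$ be the number of pairs $(\mathcal R_1,\mathcal R_2)$ of non-isotropic reflections with $\mathcal R_2(\mathcal R_1(x_i))=y_i$ for $i=1,2$, and let $\mathcal A_x(n)=|\{y\in\mathbb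 Z_q^2\times\mathbb Z_q^2:\mathcal N(x,y)=n\}|$. Conjecture for $p$: for every $x=(x_1,x_2)$ with $\|x_1-x_2\|$ a unit of $\mathbb Z_q$, the counts $\mathcal A_x(n)$ with $n\ge 1$ are $$\begin{array}{lll}\mathcal A_x(p^3-3p^2)=p^9-p^8\ (\text{if } p>3),&\mathcal A_x(p^3-p^2)=p^8,&\mathcal A_x(p^3)=p^8-2p^7+p^6,\\ \mathcal A_x(p^4-p^3)=p^6-p^5,&\mathcal A_x(p^4)=p^5-2p^4+p^3,&\mathcal A_x(p^5-p^4)=p^3-p^2,\\ \mathcal A_x(p^5)=p^2-2p+1,&\mathcal A_x(p^6-p^5)=1,\end{array}$$ and $\mathcal A_x(n)=0$ for every other $n\ge1$. Theorem. For every real $m>5/3$ and every $c>0$ there is a constant $C>0$, depending only on $m$ and $c$, such that for every prime $p\equiv3\pmod 4$ for which the conjecture above holds, and every $P\subseteq\mathbb Z_q^2$ (where $q=p^3$) with $|P|\ge c\,q^m$, one has $$|B(P)|\ge C\,q^{2(m-1)}.$$ -/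

import Mathlib

/-- The plane `(ℤ/qℤ)²`. -/
abbrev ZPlane (q : ℕ) : Type := Fin 2 → ZMod q

/-- The "distance form" `‖x‖ = x₁² + x₂²`, with values in `ℤ/qℤ`. -/
def quadNorm {q : ℕ} (v : ZPlane q) : ZMod q := v 0 ^ 2 + v 1 ^ 2

/-- The perpendicular bisector `B(x, y) = {z | ‖z - x‖ = ‖z - y‖}`. -/
def perpBisector {q : ℕ} (x y : ZPlane q) : Set (ZPlane q) :=
  {z | quadNorm (z - x) = quadNorm (z - y)}

/-- `B(P) = {B(x, y) | x, y ∈ P}`, a set of subsets of the plane. -/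
def bisectorSet {q : ℕ} (P : Finset (ZPlane q)) : Set (Set (ZPlane q)) :=
  {l | ∃ x ∈ P, ∃ y ∈ P, l = perpBisector x y}

/-- A non-isotropic line: a line `a z₁ + b z₂ = c` for which `a`, `b` and `a² + b²` are units. -/
def IsNonIsotropicLine {q : ℕ} (l : Set (ZPlane q)) : Prop :=
  ∃ a b c : ZMod q, IsUnit a ∧ IsUnit b ∧ IsUnit (a ^ 2 + b ^ 2) ∧
    l = {z | a * z 0 + b * z 1 = c}

/-- Reflections: the affine maps `v ↦ S (v - u) + u` with `S` a reflection matrix. -/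
def IsReflectionMap {q : ℕ} (f : ZPlane q → ZPlane q) : Prop :=
  ∃ (a b : ZMod q) (u : ZPlane q), a ^ 2 + b ^ 2 = 1 ∧
    ∀ v, f v = (!![a, b; b, -a] : Matrix (Fin 2) (Fin 2) (ZMod q)).mulVec (v - u) + u

/-- Reflections whose line of fixed points is non-isotropic. -/
def IsNonIsotropicReflection {q : ℕ} (f : ZPlane q → ZPlane q) : Prop :=
  IsReflectionMap f ∧ IsNonIsotropicLine {v | f v = v}

/-- `N(x, y)`: the number of pairs `(R₁, R₂)` of reflections in non-isotropic lines with
`R₂ (R₁ xᵢ) = yᵢ` for `i = 1, 2`. Reflections are counted as maps. -/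
noncomputable def reflectionPairCount {q : ℕ} (x y : ZPlane q × ZPlane q) : ℕ :=
  Set.ncard {R : (ZPlane q → ZPlane q) × (ZPlane q → ZPlane q) |
    IsNonIsotropicReflection R.1 ∧ IsNonIsotropicReflection R.2 ∧
      R.2 (R.1 x.1) = y.1 ∧ R.2 (R.1 x.2) = y.2}

/-- `A_x(n)`: the number of pairs of points `y` with `N(x, y) = n`. -/
noncomputable def reflectionLevelCount {q : ℕ} (x : ZPlane q × ZPlane q) (n : ℕ) : ℕ :=
  Set.ncard {y : ZPlane q × ZPlane q | reflectionPairCount x y = n}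

/-- The conjectured distribution of the positive values of `N(x, ·)` over `ℤ/p³ℤ`, for all pairs
`x = (x₁, x₂)` with `‖x₁ - x₂‖` a unit. The value `n = 0` is taken by all the remaining pairs `y`
(among them all those with `‖y₁ - y₂‖ ≠ ‖x₁ - x₂‖`) and is not prescribed; the guard in the first
clause matters only for `p = 3`, where `p³ - 3p² = 0`. No subtraction truncates for `p ≥ 3`. -/
def ReflectionPairConjecture (p : ℕ) : Prop :=
  ∀ x : ZPlane (p ^ 3) × ZPlane (p ^ 3), IsUnit (quadNorm (x.1 - x.2)) →
    (p ^ 3 - 3 * p ^ 2 ≠ 0 → reflectionLevelCount x (p ^ 3 - 3 * p ^ 2) = p ^ 9 - p ^ 8) ∧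
    reflectionLevelCount x (p ^ 3 - p ^ 2) = p ^ 8 ∧
    reflectionLevelCount x (p ^ 3) = p ^ 8 - 2 * p ^ 7 + p ^ 6 ∧
    reflectionLevelCount x (p ^ 4 - p ^ 3) = p ^ 6 - p ^ 5 ∧
    reflectionLevelCount x (p ^ 4) = p ^ 5 - 2 * p ^ 4 + p ^ 3 ∧
    reflectionLevelCount x (p ^ 5 - p ^ 4) = p ^ 3 - p ^ 2 ∧
    reflectionLevelCount x (p ^ 5) = p ^ 2 - 2 * p + 1 ∧
    reflectionLevelCount x (p ^ 6 - p ^ 5) = 1 ∧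
    ∀ n : ℕ, n ≠ 0 →
      n ∉ ({p ^ 3 - 3 * p ^ 2, p ^ 3 - p ^ 2, p ^ 3, p ^ 4 - p ^ 3, p ^ 4,
        p ^ 5 - p ^ 4, p ^ 5, p ^ 6 - p ^ 5} : Set ℕ) →
      reflectionLevelCount x n = 0

/-! Bisectors through a single `x ∈ P` suffice: `y ↦ perpBisector x y` is injective where `‖y - x‖`
is a unit, and since `-1` is not a square mod `p`, the other `y` are congruent to `x` mod `p`, at
most `p⁴` of them. As `m > 5/3` gives `|P| ≥ c p⁵`, this loss is harmless once `p` is large in terms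
of `c`; otherwise one bisector is enough. So `|B(P)| ≫ |P|`, and `|P| ≤ q²` gives `|P| ≥ |P|² / q² ≥
c² q^(2(m-1))`. -/

/-- Points at unit distance from `x` are determined by their perpendicular bisector with `x`. -/
theorem perpBisector_right_injective {q : ℕ} (h2 : IsUnit (2 : ZMod q)) {x y y' : ZPlane q}
    (hy : IsUnit (quadNorm (y - x))) (h : perpBisector x y = perpBisector x y') : y = y' := by
  obtain ⟨k, hk⟩ := h2.exists_right_inv
  -- With `k = 1/2`: the midpoint of `x` and `y`, moved by `t` times `y - x` turned through a right
  -- angle.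
  have mid : ∀ t : ZMod q, ![k * (x 0 + y 0) - t * (y 1 - x 1), k * (x 1 + y 1) + t * (y 0 - x 0)]
      ∈ perpBisector x y' := by
    intro t
    rw [← h]
    simp only [perpBisector, quadNorm, Set.mem_ofPred_eq, Pi.sub_apply, Matrix.cons_val_zero,
      Matrix.cons_val_one]
    linear_combination ((y 0 - x 0) * (x 0 + y 0) + (y 1 - x 1) * (x 1 + y 1)) * hk
  have mid' : ![k * (x 0 + y' 0), k * (x 1 + y' 1)] ∈ perpBisector x y := by
    rw [h]
    simp only [perpBisector, quadNorm, Set.mem_ofPred_eq, Pi.sub_apply, Matrix.cons_val_zero,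
      Matrix.cons_val_one]
    linear_combination ((y' 0 - x 0) * (x 0 + y' 0) + (y' 1 - x 1) * (x 1 + y' 1)) * hk
  have h0 := mid 0
  -- Taking `t = 1/2` cancels the factor 2 in `h1 - h0`.
  have h1 := mid k
  simp only [perpBisector, quadNorm, Set.mem_ofPred_eq, Pi.sub_apply, Matrix.cons_val_zero,
    Matrix.cons_val_one] at h0 h1 mid' hy
  have hdot : (y 0 - x 0) * (y' 0 - y 0) + (y 1 - x 1) * (y' 1 - y 1) = 0 := by
    linear_combination mid' - ((x 0 + y' 0) * (y 0 - x 0) + (x 1 + y' 1) * (y 1 - x 1)) * hk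
  have hcross : (y 0 - x 0) * (y' 1 - y 1) - (y 1 - x 1) * (y' 0 - y 0) = 0 := by
    linear_combination h1 - h0
      - ((y 0 - x 0) * (y' 1 - y 1) - (y 1 - x 1) * (y' 0 - y 0)) * hk
  -- `y' - y` is both orthogonal and parallel to `y - x`; solving this 2×2 system has determinant
  -- `‖y - x‖`, a unit.
  have e0 : y' 0 - y 0 = 0 := hy.mul_right_eq_zero.1 (by
    linear_combination (y 0 - x 0) * hdot - (y 1 - x 1) * hcross)
  have e1 : y' 1 - y 1 = 0 := hy.mul_right_eq_zero.1 (by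
    linear_combination (y 1 - x 1) * hdot + (y 0 - x 0) * hcross)
  funext i
  fin_cases i
  · exact (sub_eq_zero.1 e0).symm
  · exact (sub_eq_zero.1 e1).symm

/-- For `p ≡ 3 (mod 4)` the form `‖·‖` is anisotropic modulo `p`. -/
theorem dvd_val_of_not_isUnit_quadNorm {p n : ℕ} (hp : p.Prime) (hp4 : p % 4 = 3)
    {v : ZPlane (p ^ n)} (hv : ¬ IsUnit (quadNorm v)) : ∀ i, p ∣ (v i).val := by
  have : Fact p.Prime := ⟨hp⟩
  have : NeZero (p ^ n) := ⟨pow_ne_zero _ hp.ne_zero⟩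
  have hdvd : p ∣ (v 0).val ^ 2 + (v 1).val ^ 2 := by
    by_contra hnd
    refine hv ?_
    have : quadNorm v = (((v 0).val ^ 2 + (v 1).val ^ 2 : ℕ) : ZMod (p ^ n)) := by
      simp [quadNorm]
    rw [this, ZMod.isUnit_iff_coprime]
    exact ((hp.coprime_iff_not_dvd.2 hnd).symm).pow_right n
  have key : ∀ a b : ℕ, p ∣ a ^ 2 + b ^ 2 → p ∣ a := by
    intro a b hab
    by_contra ha
    have h0 : (a : ZMod p) ≠ 0 := by rwa [Ne, ZMod.natCast_eq_zero_iff]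
    have h1 : (b : ZMod p) ^ 2 = -(a : ZMod p) ^ 2 := by
      have := (ZMod.natCast_eq_zero_iff (a ^ 2 + b ^ 2) p).2 hab
      push_cast at this
      linear_combination this
    exact ZMod.mod_four_ne_three_of_sq_eq_neg_sq' h0 h1 hp4
  intro i
  fin_cases i
  · exact key _ _ hdvd
  · exact key _ _ (by rwa [add_comm])

/-- Both coordinates of `y - x` are multiples of `p`, leaving `p²` choices for each. -/
theorem card_not_isUnit_quadNorm_le {p : ℕ} (hp : p.Prime) (hp4 : p % 4 = 3)
    (x : ZPlane (p ^ 3)) (P : Finset (ZPlane (p ^ 3)))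
    [DecidablePred fun y : ZPlane (p ^ 3) => IsUnit (quadNorm (y - x))] :
    (P.filter fun y => ¬ IsUnit (quadNorm (y - x))).card ≤ p ^ 4 := by
  have : NeZero (p ^ 3) := ⟨pow_ne_zero _ hp.ne_zero⟩
  have hcard : (Finset.range (p ^ 2) ×ˢ Finset.range (p ^ 2)).card = p ^ 4 := by
    rw [Finset.card_product, Finset.card_range]; ring
  rw [← hcard]
  refine Finset.card_le_card_of_injOn
    (fun y => (((y - x) 0).val / p, ((y - x) 1).val / p)) ?_ ?_
  · intro y _
    have hlt : ∀ a : ZMod (p ^ 3), a.val / p < p ^ 2 := fun a =>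
      Nat.div_lt_of_lt_mul (a.val_lt.trans_eq (pow_succ' p 2))
    simp only [Finset.coe_product, Finset.coe_range, Set.mem_prod, Set.mem_Iio]
    exact ⟨hlt _, hlt _⟩
  · intro y hy y' hy' h
    have dy := dvd_val_of_not_isUnit_quadNorm hp hp4 (Finset.mem_filter.1 hy).2
    have dy' := dvd_val_of_not_isUnit_quadNorm hp hp4 (Finset.mem_filter.1 hy').2
    obtain ⟨h0, h1⟩ := Prod.ext_iff.1 h
    have : y - x = y' - x := by
      funext i
      apply ZMod.val_injective
      fin_cases i
      · exact (Nat.div_left_inj (dy 0) (dy' 0)).1 h0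
      · exact (Nat.div_left_inj (dy 1) (dy' 1)).1 h1
    exact sub_left_inj.1 this

theorem bisectorSet_finite {q : ℕ} (P : Finset (ZPlane q)) : (bisectorSet P).Finite := by
  refine ((P ×ˢ P).finite_toSet.image fun z => perpBisector z.1 z.2).subset ?_
  rintro l ⟨x, hx, y, hy, rfl⟩
  exact ⟨(x, y), by simp [hx, hy], rfl⟩

/-- Bisectors through a fixed point already give `|P| ≤ |B(P)| + p⁴`. -/
theorem card_le_ncard_bisectorSet_add {p : ℕ} (hp : p.Prime) (hp4 : p % 4 = 3)
    (P : Finset (ZPlane (p ^ 3))) : P.card ≤ (bisectorSet P).ncard + p ^ 4 := by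
  classical
  obtain rfl | ⟨x, hx⟩ := P.eq_empty_or_nonempty
  · simp
  have h2 : IsUnit (2 : ZMod (p ^ 3)) := by
    have : (2 : ZMod (p ^ 3)) = ((2 : ℕ) : ZMod (p ^ 3)) := by norm_num
    rw [this, ZMod.isUnit_iff_coprime]
    refine Nat.Coprime.pow_right 3 ((Nat.coprime_primes Nat.prime_two hp).2 ?_)
    omega
  rw [← P.card_filter_add_card_filter_not fun y => IsUnit (quadNorm (y - x))]
  refine add_le_add ?_ (card_not_isUnit_quadNorm_le hp hp4 x P)
  rw [← Set.ncard_coe_finset]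
  refine Set.ncard_le_ncard_of_injOn (perpBisector x) ?_ ?_ (bisectorSet_finite P)
  · intro y hy
    exact ⟨x, hx, y, (Finset.mem_filter.1 hy).1, rfl⟩
  · intro y hy y' _ h
    exact perpBisector_right_injective h2 (Finset.mem_filter.1 hy).2 h

theorem one_le_ncard_bisectorSet {q : ℕ} {P : Finset (ZPlane q)} (hP : P.Nonempty) :
    1 ≤ (bisectorSet P).ncard := by
  obtain ⟨x, hx⟩ := hP
  exact (Set.ncard_pos (bisectorSet_finite P)).2 ⟨_, x, hx, x, hx, rfl⟩

theorem card_le_sq {q : ℕ} [NeZero q] (P : Finset (ZPlane q)) : P.card ≤ q ^ 2 := by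
  simpa [ZMod.card] using P.card_le_univ

/-- A set of at least `c p⁵` points has at least a constant proportion as many bisectors. -/
theorem mul_card_le_ncard_bisectorSet {p : ℕ} (hp : p.Prime) (hp4 : p % 4 = 3) {c : ℝ}
    (hc : 0 < c) {P : Finset (ZPlane (p ^ 3))} (hP : c * (p : ℝ) ^ 5 ≤ P.card) :
    min (1 / 2) (c ^ 4 / 32) * P.card ≤ ((bisectorSet P).ncard : ℝ) := by
  have hp0 : (0 : ℝ) < p := by exact_mod_cast hp.pos
  have hcard : (P.card : ℝ) ≤ (bisectorSet P).ncard + (p : ℝ) ^ 4 := by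
    exact_mod_cast card_le_ncard_bisectorSet_add hp hp4 P
  by_cases hbig : 2 * (p : ℝ) ^ 4 ≤ P.card
  · calc min (1 / 2) (c ^ 4 / 32) * (P.card : ℝ) ≤ 1 / 2 * P.card := by
          gcongr; exact min_le_left _ _
      _ ≤ _ := by linarith
  · rw [not_le] at hbig
    -- Here `p ≤ 2/c`, so `|P| < 2p⁴ ≤ 32/c⁴`: the constant `c⁴/32` brings the left side down to 1,
    -- which the degenerate bisector `B(x, x)` already supplies.
    have hne : P.Nonempty := by
      rw [← Finset.card_pos]
      exact_mod_cast (by positivity : (0 : ℝ) < c * (p : ℝ) ^ 5).trans_le hP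
    have hcp : c * p ≤ 2 := by
      refine le_of_mul_le_mul_right ?_ (by positivity : (0 : ℝ) < (p : ℝ) ^ 4)
      linarith [show c * p * (p : ℝ) ^ 4 = c * (p : ℝ) ^ 5 by ring]
    calc min (1 / 2) (c ^ 4 / 32) * (P.card : ℝ) ≤ c ^ 4 / 32 * (2 * (p : ℝ) ^ 4) := by
          gcongr; exact min_le_right _ _
      _ = (c * p) ^ 4 / 16 := by ring
      _ ≤ 2 ^ 4 / 16 := by gcongr
      _ = 1 := by norm_num
      _ ≤ _ := by exact_mod_cast one_le_ncard_bisectorSet hne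

theorem mainTheorem5 (m : ℝ) (hm : 5 / 3 < m) (c : ℝ) (hc : 0 < c) :
    ∃ C : ℝ, 0 < C ∧ ∀ p : ℕ, p.Prime → p % 4 = 3 → ReflectionPairConjecture p →
      ∀ P : Finset (ZPlane (p ^ 3)),
        c * ((p ^ 3 : ℕ) : ℝ) ^ m ≤ (P.card : ℝ) →
          C * ((p ^ 3 : ℕ) : ℝ) ^ (2 * (m - 1)) ≤ ((bisectorSet P).ncard : ℝ) := by
  refine ⟨min (1 / 2) (c ^ 4 / 32) * c ^ 2, by positivity, ?_⟩
  intro p hp hp4 _ P hP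
  have : NeZero (p ^ 3) := ⟨pow_ne_zero _ hp.ne_zero⟩
  have hq1 : (1 : ℝ) ≤ ((p ^ 3 : ℕ) : ℝ) := by exact_mod_cast Nat.one_le_pow _ _ hp.pos
  have hq0 : (0 : ℝ) < ((p ^ 3 : ℕ) : ℝ) := by linarith
  have hp5 : c * (p : ℝ) ^ 5 ≤ P.card := by
    refine le_trans ?_ hP
    gcongr
    calc (p : ℝ) ^ 5 = ((p ^ 3 : ℕ) : ℝ) ^ (5 / 3 : ℝ) := by
          push_cast
          rw [← Real.rpow_natCast_mul (by positivity), ← Real.rpow_natCast]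
          norm_num
      _ ≤ _ := Real.rpow_le_rpow_of_exponent_le hq1 hm.le
  have hsq : c ^ 2 * ((p ^ 3 : ℕ) : ℝ) ^ (2 * (m - 1)) ≤ P.card := by
    have hpow : ((p ^ 3 : ℕ) : ℝ) ^ (2 * (m - 1)) * ((p ^ 3 : ℕ) : ℝ) ^ 2
        = (((p ^ 3 : ℕ) : ℝ) ^ m) ^ 2 := by
      rw [← Real.rpow_natCast _ 2, ← Real.rpow_add hq0, ← Real.rpow_mul_natCast hq0.le]
      push_cast
      ring_nf
    have hle : (P.card : ℝ) ≤ ((p ^ 3 : ℕ) : ℝ) ^ 2 := by exact_mod_cast card_le_sq P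
    refine le_of_mul_le_mul_right ?_ (pow_pos hq0 2)
    calc c ^ 2 * ((p ^ 3 : ℕ) : ℝ) ^ (2 * (m - 1)) * ((p ^ 3 : ℕ) : ℝ) ^ 2
        = (c * ((p ^ 3 : ℕ) : ℝ) ^ m) ^ 2 := by rw [mul_assoc, hpow, mul_pow]
      _ ≤ (P.card : ℝ) ^ 2 := by gcongr
      _ ≤ P.card * ((p ^ 3 : ℕ) : ℝ) ^ 2 := by rw [sq]; gcongr
  calc _ = min (1 / 2) (c ^ 4 / 32) * (c ^ 2 * ((p ^ 3 : ℕ) : ℝ) ^ (2 * (m - 1))) := by ring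
    _ ≤ min (1 / 2) (c ^ 4 / 32) * P.card := by gcongr
    _ ≤ _ := mul_card_le_ncard_bisectorSet hp hp4 hc hp5
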